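/- A real number $\beta>1$ is called univoque if there exists a unique sequence of integers $(s_n)_{n\ge 1}$ with $0\le s_n<\beta$ for all $n$ such that $1=\sum_{n\ge 1}s_n\beta^{-n}$. A Pisot number is a real algebraic integer $\beta>1$ all of whose algebraic conjugates other than $\beta$ itself have modulus $<1$. Let $\mathcal U$ be the set of univoque real numbers in the open interval $(1,2)$. Then there exists a smallest Pisot number in $\mathcal U$; that is, the set of Pisot numbers belonging to $\mathcal U$ is non-empty and has a least element. -/

import Mathlib

open Polynomial

/-- A Pisot number: a real algebraic integer `β > 1` all of whose algebraic conjugates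
(complex roots of its minimal polynomial over `ℚ`) other than `β` itself have modulus `< 1`. -/
def IsPisot (β : ℝ) : Prop :=
  1 < β ∧ IsIntegral ℤ β ∧
    ∀ z : ℂ, aeval z (minpoly ℚ β) = 0 → z ≠ (β : ℂ) → ‖z‖ < 1

/-- `s` represents `1` in base `β`: the integer digits satisfy `0 ≤ s n < β` and
`1 = ∑ s n * β ^ (-(n + 1))`. Digits are indexed from `0`: `s n` is the `(n + 1)`-st digit. -/
def RepresentsOne (β : ℝ) (s : ℕ → ℤ) : Prop :=
  (∀ n, 0 ≤ s n ∧ (s n : ℝ) < β) ∧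
    HasSum (fun n : ℕ => (s n : ℝ) / β ^ (n + 1)) 1

/-- A real number `β > 1` is univoque if `1` has exactly one representation in base `β`. -/
def IsUnivoque (β : ℝ) : Prop :=
  1 < β ∧ ∃! s : ℕ → ℤ, RepresentsOne β s

/-- The set of univoque real numbers in the open interval `(1, 2)`. -/
def univoqueSet : Set ℝ :=
  {β | β ∈ Set.Ioo (1 : ℝ) 2 ∧ IsUnivoque β}

/-!
A set of reals that is bounded below attains its infimum as soon as that infimum belongs to it.
The univoque Pisot numbers in `(1, 2)` are bounded below by `3 / 2`, since the first digit of the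
expansion of `1` is forced, and there are some: the expansion `11(10)^∞` gives one near `1.905`.
So everything rests on two limit properties.

*Univoque numbers.* A base is univoque exactly when every digit of the expansion of `1` is forced by
strict inequalities on the remainders. In a limit from above these inequalities become weak. Those
for the digit `0` stay strict because the remainders increase with the base; those for the digit `1`
stay strict because equality makes the expansion restart as its own reflection, which would yield
equality at a digit `0`.

*Pisot numbers* form a closed set (Salem). If `P` is the minimal polynomial of a Pisot number `β`
and `P*` its reversal, the Taylor coefficients `u k` of `P / P*` are integers, and
`∑ (u (k + 1) - β * u k) ^ 2` is bounded in terms of `β` because `P / P*` is a Blaschke product up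
to one factor. If `P / P*` is a polynomial then `β` is a quadratic unit, and the traces
`β ^ k + β⁻¹ ^ k` are used instead. Such sequences, shifted to start large, have a nonzero limit
along Pisot numbers tending to `θ`. Conversely (Pisot), an integer sequence `v` that is not
eventually zero with `∑ (v (k + 1) - θ * v k) ^ 2` finite forces `θ > 1` to be a Pisot number: its
Hankel determinants are integers tending to `0`, so by Kronecker it satisfies a linear recurrence,
by Fatou even a monic one, and its other characteristic roots must not contribute to the
growth, which confines the conjugates of `θ` to the open unit disc.
-/

open Filter Topology

/-- The remainders `x_n` of `x` after `n` steps of the digit expansion `s` in base `β`: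
`x_0 = x` and `x_{n+1} = β x_n - s_n`. -/
def remainder (β : ℝ) (s : ℕ → ℤ) (x : ℝ) : ℕ → ℝ
  | 0 => x
  | n + 1 => β * remainder β s x n - s n

/-- `s` expands `x` in base `β` with digits `0` and `1`. Convergence is encoded by the remainders
staying in `[0, 1 / (β - 1)]`; see `isBinaryExpansion_iff_hasSum`. -/
def IsBinaryExpansion (β : ℝ) (s : ℕ → ℤ) (x : ℝ) : Prop :=
  (∀ n, s n = 0 ∨ s n = 1) ∧ ∀ n, 0 ≤ remainder β s x n ∧ (β - 1) * remainder β s x n ≤ 1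

/-- At no step of the expansion `s` of `x` is the other digit possible: digit `1` needs
`1 ≤ β x_n`, digit `0` needs `β x_n ≤ 1 / (β - 1)`. -/
def IsForced (β : ℝ) (s : ℕ → ℤ) (x : ℝ) : Prop :=
  ∀ n, (s n = 0 → β * remainder β s x n < 1) ∧ (s n = 1 → 1 < (β - 1) * (β * remainder β s x n))

/-- The closed version of `IsForced`, which survives limits in `β`. -/
def IsWeaklyForced (β : ℝ) (s : ℕ → ℤ) (x : ℝ) : Prop :=
  ∀ n, (s n = 0 → β * remainder β s x n ≤ 1) ∧ (s n = 1 → 1 ≤ (β - 1) * (β * remainder β s x n))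

section Remainder

variable {β x : ℝ} {s t : ℕ → ℤ}

theorem remainder_congr {n : ℕ} (h : ∀ k < n, s k = t k) :
    remainder β s x n = remainder β t x n := by
  induction n with
  | zero => rfl
  | succ n ih => rw [remainder, remainder, ih fun k hk => h k (by omega), h n (by omega)]

theorem remainder_add (β x : ℝ) (s : ℕ → ℤ) (m n : ℕ) :
    remainder β s x (m + n) = remainder β (fun k => s (m + k)) (remainder β s x m) n := by
  induction n with
  | zero => rfl
  | succ n ih => rw [← add_assoc, remainder, remainder, ih]

theorem continuous_remainder (s : ℕ → ℤ) (x : ℝ) (n : ℕ) :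
    Continuous fun β => remainder β s x n := by
  induction n with
  | zero => exact continuous_const
  | succ n ih => exact (continuous_id.mul ih).sub continuous_const

theorem remainder_le_remainder {θ : ℝ} (hβ : 0 ≤ β) (hθβ : θ ≤ β)
    (h0 : ∀ n, 0 ≤ remainder θ s x n) (n : ℕ) : remainder θ s x n ≤ remainder β s x n := by
  induction n with
  | zero => rfl
  | succ n ih => exact sub_le_sub_right (mul_le_mul hθβ ih (h0 n) hβ) _

theorem sum_digits_eq (hβ : β ≠ 0) (s : ℕ → ℤ) (x : ℝ) (n : ℕ) :
    ∑ k ∈ Finset.range n, (s k : ℝ) / β ^ (k + 1) = x - remainder β s x n / β ^ n := by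
  induction n with
  | zero => simp [remainder]
  | succ n ih =>
    rw [Finset.sum_range_succ, ih, remainder]
    field_simp
    ring

theorem hasSum_remainder (hβ : β ≠ 0) (hs : HasSum (fun n => (s n : ℝ) / β ^ (n + 1)) x) (n : ℕ) :
    HasSum (fun k => (s (n + k) : ℝ) / β ^ (k + 1)) (remainder β s x n) := by
  have htail := ((hasSum_nat_add_iff' n).2 hs).mul_left (β ^ n)
  rw [sum_digits_eq hβ s x, sub_sub_cancel, mul_div_cancel₀ _ (pow_ne_zero n hβ)] at htail
  refine htail.congr_fun fun k => ?_
  rw [add_comm k n, add_assoc, pow_add]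
  field_simp
  ring

theorem hasSum_one_div_pow_succ (hβ : 1 < β) :
    HasSum (fun n : ℕ => 1 / β ^ (n + 1)) (1 / (β - 1)) := by
  have hgeom := (hasSum_geometric_of_lt_one (by positivity) (inv_lt_one_of_one_lt₀ hβ)).mul_left β⁻¹
  have hsum : β⁻¹ * (1 - β⁻¹)⁻¹ = 1 / (β - 1) := by
    rw [← mul_inv, mul_sub, mul_one, mul_inv_cancel₀ (by linarith), one_div]
  rw [hsum] at hgeom
  exact hgeom.congr_fun fun n => by rw [one_div, pow_succ', mul_inv, inv_pow]

theorem isBinaryExpansion_iff_hasSum (hβ : 1 < β) : IsBinaryExpansion β s x ↔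
    (∀ n, s n = 0 ∨ s n = 1) ∧ HasSum (fun n => (s n : ℝ) / β ^ (n + 1)) x := by
  have hβ0 : 0 < β := by linarith
  have hβ1 : 0 < β - 1 := by linarith
  refine and_congr_right fun hdigit => ?_
  have hs01 : ∀ n, (0 : ℝ) ≤ s n ∧ (s n : ℝ) ≤ 1 := fun n => by
    rcases hdigit n with h | h <;> simp [h]
  constructor
  · intro hr
    rw [hasSum_iff_tendsto_nat_of_nonneg fun n => div_nonneg (hs01 n).1 (by positivity)]
    simp_rw [sum_digits_eq hβ0.ne' s x]
    have hlim : Tendsto (fun n => remainder β s x n / β ^ n) atTop (𝓝 0) := by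
      refine squeeze_zero (fun n => div_nonneg (hr n).1 (by positivity))
        (g := fun n => 1 / (β - 1) * β⁻¹ ^ n) (fun n => ?_) ?_
      · rw [div_eq_mul_inv, inv_pow]
        gcongr
        rw [le_div_iff₀' hβ1]
        exact (hr n).2
      · simpa using (tendsto_pow_atTop_nhds_zero_of_lt_one (by positivity)
          (inv_lt_one_of_one_lt₀ hβ)).const_mul (1 / (β - 1))
    simpa using hlim.const_sub x
  · intro hs n
    have htail := hasSum_remainder hβ0.ne' hs n
    refine ⟨htail.nonneg fun k => div_nonneg (hs01 _).1 (by positivity), ?_⟩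
    rw [← le_div_iff₀' hβ1]
    exact hasSum_le (fun k => by gcongr; exact (hs01 _).2) htail (hasSum_one_div_pow_succ hβ)

theorem representsOne_iff_isBinaryExpansion (h1 : 1 < β) (h2 : β ≤ 2) :
    RepresentsOne β s ↔ IsBinaryExpansion β s 1 := by
  rw [isBinaryExpansion_iff_hasSum h1, RepresentsOne]
  refine and_congr_left fun _ => forall_congr' fun n => ⟨fun hn => ?_, ?_⟩
  · have := hn.1
    have hn2 : s n < 2 := by exact_mod_cast hn.2.trans_le h2
    omega
  · rintro (h | h) <;> simp only [h] <;> norm_num <;> linarith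

end Remainder

section Univoque

variable {β x : ℝ} {s t : ℕ → ℤ}

theorem exists_isBinaryExpansion (h1 : 1 < β) (h2 : β ≤ 2) (hx0 : 0 ≤ x) (hx1 : (β - 1) * x ≤ 1) :
    ∃ s, IsBinaryExpansion β s x := by
  have hdigit : ∀ y, ∃ d : ℤ, (d = 0 ∨ d = 1) ∧ (0 ≤ y ∧ (β - 1) * y ≤ 1 →
      0 ≤ β * y - d ∧ (β - 1) * (β * y - d) ≤ 1) := by
    intro y
    rcases le_or_gt 1 (β * y) with hy | hy
    · refine ⟨1, Or.inr rfl, fun hy' => ?_⟩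
      push_cast
      exact ⟨by linarith, by nlinarith⟩
    · refine ⟨0, Or.inl rfl, fun hy' => ?_⟩
      push_cast
      exact ⟨by nlinarith, by nlinarith⟩
  choose d hd01 hd using hdigit
  have horbit : ∀ n, remainder β (fun k => d ((fun y => β * y - d y)^[k] x)) x n =
      (fun y => β * y - d y)^[n] x := by
    intro n
    induction n with
    | zero => rfl
    | succ n ih => rw [remainder, ih, Function.iterate_succ_apply']
  refine ⟨fun k => d ((fun y => β * y - d y)^[k] x), fun n => hd01 _, fun n => ?_⟩
  rw [horbit]
  induction n with
  | zero => exact ⟨hx0, hx1⟩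
  | succ n ih =>
    rw [Function.iterate_succ_apply']
    exact hd _ ih

theorem IsBinaryExpansion.exists_digit_eq (hs : IsBinaryExpansion β s x) (h1 : 1 < β) (h2 : β ≤ 2)
    (n : ℕ) {d : ℤ} (hd : d = 0 ∨ d = 1) (h0 : 0 ≤ β * remainder β s x n - d)
    (hle : (β - 1) * (β * remainder β s x n - d) ≤ 1) :
    ∃ t, IsBinaryExpansion β t x ∧ t n = d := by
  obtain ⟨r, hr, hr_rem⟩ := exists_isBinaryExpansion h1 h2 h0 hle
  set t : ℕ → ℤ := fun k => if k < n then s k else if k = n then d else r (k - (n + 1)) with ht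
  have htn : t n = d := by simp [ht]
  have hprefix : ∀ k ≤ n, remainder β t x k = remainder β s x k := fun k hk =>
    remainder_congr fun i hi => by simp [ht, show i < n by omega]
  have htail : (fun k => t (n + 1 + k)) = r := by
    funext k
    simp [ht, show ¬ n + 1 + k < n by omega, show n + 1 + k ≠ n by omega]
  refine ⟨t, ⟨fun k => ?_, fun k => ?_⟩, htn⟩
  · simp only [ht]
    split_ifs
    exacts [hs.1 k, hd, hr _]
  · rcases le_or_gt k n with hk | hk
    · rw [hprefix k hk]
      exact hs.2 k
    · obtain ⟨j, rfl⟩ := Nat.exists_eq_add_of_le hk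
      rw [remainder_add, htail, remainder, hprefix n le_rfl, htn]
      exact hr_rem j

theorem IsBinaryExpansion.isForced_of_unique (hs : IsBinaryExpansion β s x) (h1 : 1 < β)
    (h2 : β ≤ 2) (huniq : ∀ t, IsBinaryExpansion β t x → t = s) : IsForced β s x := by
  intro n
  have hn := hs.2 n
  have hn1 := hs.2 (n + 1)
  rw [remainder] at hn1
  constructor <;> intro hdigit <;> by_contra! hother
  · obtain ⟨t, ht, htn⟩ := hs.exists_digit_eq h1 h2 n (Or.inr rfl) (by push_cast; linarith)
      (by rw [hdigit] at hn1; push_cast at *; nlinarith)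
    rw [huniq t ht] at htn
    omega
  · obtain ⟨t, ht, htn⟩ := hs.exists_digit_eq h1 h2 n (Or.inl rfl)
      (by push_cast; nlinarith [hn.1]) (by push_cast; linarith)
    rw [huniq t ht] at htn
    omega

theorem IsForced.eq (hs : IsBinaryExpansion β s x) (hforced : IsForced β s x)
    (ht : IsBinaryExpansion β t x) : t = s := by
  funext n
  induction n using Nat.strong_induction_on with
  | _ n ih =>
    have hrem : remainder β t x n = remainder β s x n := remainder_congr ih
    have hn1 := ht.2 (n + 1)
    rw [remainder, hrem] at hn1
    rcases hs.1 n with h | h <;> rcases ht.1 n with h' | h' <;> rw [h'] at hn1 ⊢ <;>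
      push_cast at hn1
    · exact h.symm
    · linarith [(hforced n).1 h]
    · linarith [(hforced n).2 h]
    · exact h.symm

theorem isUnivoque_iff_exists_isForced (h1 : 1 < β) (h2 : β ≤ 2) :
    IsUnivoque β ↔ ∃ s, IsBinaryExpansion β s 1 ∧ IsForced β s 1 := by
  simp only [IsUnivoque, h1, true_and, representsOne_iff_isBinaryExpansion h1 h2]
  exact ⟨fun ⟨s, hs, huniq⟩ => ⟨s, hs, hs.isForced_of_unique h1 h2 huniq⟩,
    fun ⟨s, hs, hforced⟩ => ⟨s, hs, fun t ht => hforced.eq hs ht⟩⟩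

theorem IsUnivoque.one_lt_sub_one_mul_self (h : IsUnivoque β) (h2 : β ≤ 2) : 1 < (β - 1) * β := by
  obtain ⟨s, hs, hforced⟩ := (isUnivoque_iff_exists_isForced h.1 h2).1 h
  have hfirst := hforced 0
  simp only [remainder, mul_one] at hfirst
  rcases hs.1 0 with h0 | h0
  · linarith [h.1, hfirst.1 h0]
  · exact hfirst.2 h0

-- `y ↦ 1 / (β - 1) - y` exchanges the two digits and commutes with the expansion.
theorem IsWeaklyForced.reflect {y : ℝ} (h1 : 1 < β) (h2 : β < 2) (hs01 : ∀ n, s n = 0 ∨ s n = 1)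
    (ht01 : ∀ n, t n = 0 ∨ t n = 1) (hs : IsWeaklyForced β s x) (ht : IsWeaklyForced β t y)
    (hxy : (β - 1) * (x + y) = 1) (n : ℕ) :
    (β - 1) * (remainder β s x n + remainder β t y n) = 1 ∧ s n + t n = 1 := by
  have hdigits : ∀ n, (β - 1) * (remainder β s x n + remainder β t y n) = 1 → s n + t n = 1 := by
    intro n hn
    rcases hs01 n with h | h <;> rcases ht01 n with h' | h'
    · nlinarith [(hs n).1 h, (ht n).1 h']
    · omega
    · omega
    · nlinarith [(hs n).2 h, (ht n).2 h']
  have hrem : (β - 1) * (remainder β s x n + remainder β t y n) = 1 := by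
    induction n with
    | zero => exact hxy
    | succ n ih =>
      have hsum : (s n : ℝ) + t n = 1 := by exact_mod_cast hdigits n ih
      rw [remainder, remainder]
      linear_combination β * ih - (β - 1) * hsum
  exact ⟨hrem, hdigits n hrem⟩

-- If the digit `1` at time `n` is only weakly forced, the expansion restarts at time `n + 1` as its
-- own reflection, and the critical step reappears at time `2n + 1` with the digit `0`.
theorem IsWeaklyForced.isForced (h1 : 1 < β) (h2 : β < 2) (hs01 : ∀ n, s n = 0 ∨ s n = 1)
    (hs : IsWeaklyForced β s 1) (hzero : ∀ n, s n = 0 → β * remainder β s 1 n ≠ 1) :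
    IsForced β s 1 := by
  refine fun n => ⟨fun hn => ((hs n).1 hn).lt_of_ne (hzero n hn),
    fun hn => ((hs n).2 hn).lt_of_ne' fun hcritical => ?_⟩
  have htail : IsWeaklyForced β (fun k => s (n + 1 + k)) (remainder β s 1 (n + 1)) := fun k => by
    simpa only [← remainder_add] using hs (n + 1 + k)
  have hrestart : (β - 1) * (1 + remainder β s 1 (n + 1)) = 1 := by
    rw [remainder, hn]
    push_cast
    linear_combination hcritical
  obtain ⟨hrem, hdigit⟩ := hs.reflect h1 h2 hs01 (fun k => hs01 _) htail hrestart n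
  rw [← remainder_add] at hrem
  refine hzero (n + 1 + n) (by omega) (mul_left_cancel₀ (sub_pos.2 h1).ne' ?_)
  linear_combination β * hrem - hcritical

end Univoque

section Limits

theorem exists_forall_eventually_eq_of_finite {α β : Type*} (F : Ultrafilter α) {u : α → ℕ → β}
    {T : ℕ → Set β} (hT : ∀ k, (T k).Finite) (hu : ∀ k, ∀ᶠ a in F, u a k ∈ T k) :
    ∃ v : ℕ → β, ∀ n, ∀ᶠ a in F, ∀ k < n, u a k = v k := by
  have hlim : ∀ k, ∃ b, ∀ᶠ a in F, u a k = b := fun k => by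
    obtain ⟨b, -, hb⟩ := (Ultrafilter.eventually_exists_mem_iff (P := fun b a => u a k = b)
      (hT k)).1 ((hu k).mono fun a ha => ⟨u a k, ha, rfl⟩)
    exact ⟨b, hb⟩
  choose v hv using hlim
  exact ⟨v, fun n => (eventually_all_finite (Set.finite_Iio n)).2 fun k _ => hv k⟩

theorem exists_limit_digits {θ : ℝ} (h2 : θ < 2) {F : Ultrafilter ℝ} (hF : ↑F ≤ 𝓝[>] θ)
    (hU : ∀ᶠ β in F, IsUnivoque β) : ∃ d : ℕ → ℤ, ∀ n, ∀ᶠ β in F, (d n = 0 ∨ d n = 1) ∧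
      (0 ≤ remainder β d 1 n ∧ (β - 1) * remainder β d 1 n ≤ 1) ∧
      (d n = 0 → β * remainder β d 1 n < 1) ∧
      (d n = 1 → 1 < (β - 1) * (β * remainder β d 1 n)) := by
  have hlt2 : ∀ᶠ β : ℝ in F, β < 2 := hF (mem_nhdsWithin_of_mem_nhds (Iio_mem_nhds h2))
  have hexpansion : ∀ᶠ β in F, ∃ s, IsBinaryExpansion β s 1 ∧ IsForced β s 1 := by
    filter_upwards [hU, hlt2] with β hβ hβ2
    exact (isUnivoque_iff_exists_isForced hβ.1 hβ2.le).1 hβ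
  obtain ⟨s, hs⟩ := hexpansion.choice
  obtain ⟨d, hd⟩ := exists_forall_eventually_eq_of_finite F (u := s) (T := fun _ => {0, 1})
    (fun _ => Set.toFinite _) fun k => hs.mono fun β hβ => hβ.1.1 k
  refine ⟨d, fun n => ?_⟩
  filter_upwards [hs, hd (n + 1)] with β hβ hprefix
  rw [← hprefix n (by omega),
    ← remainder_congr (s := s β) fun k hk => hprefix k (by omega)]
  exact ⟨hβ.1.1 n, hβ.1.2 n, hβ.2 n⟩

theorem isUnivoque_of_frequently_nhdsGT {θ : ℝ} (h1 : 1 < θ) (h2 : θ < 2)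
    (h : ∃ᶠ β in 𝓝[>] θ, IsUnivoque β) : IsUnivoque θ := by
  obtain ⟨F, hF⟩ := exists_ultrafilter_iff.2
    (frequently_mem_iff_neBot (s := {β | IsUnivoque β}) |>.1 h)
  obtain ⟨hFθ, hFU⟩ := le_inf_iff.1 hF
  have hU : ∀ᶠ β in F, IsUnivoque β := le_principal_iff.1 hFU
  obtain ⟨d, hd⟩ := exists_limit_digits h2 hFθ hU
  have hβθ : Tendsto id F (𝓝 θ) := hFθ.trans nhdsWithin_le_nhds
  have hrem : ∀ n, Tendsto (fun β => remainder β d 1 n) F (𝓝 (remainder θ d 1 n)) := fun n =>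
    ((continuous_remainder d 1 n).tendsto θ).comp hβθ
  have hβrem : ∀ n, Tendsto (fun β => β * remainder β d 1 n) F (𝓝 (θ * remainder θ d 1 n)) :=
    fun n => hβθ.mul (hrem n)
  have hd01 : ∀ n, d n = 0 ∨ d n = 1 := fun n => (hd n).exists.choose_spec.1
  have hbinary : IsBinaryExpansion θ d 1 := ⟨hd01, fun n =>
    ⟨ge_of_tendsto (hrem n) ((hd n).mono fun β hβ => hβ.2.1.1),
      le_of_tendsto ((hβθ.sub_const 1).mul (hrem n)) ((hd n).mono fun β hβ => hβ.2.1.2)⟩⟩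
  have hweak : IsWeaklyForced θ d 1 := fun n =>
    ⟨fun h0 => le_of_tendsto (hβrem n) ((hd n).mono fun β hβ => (hβ.2.2.1 h0).le),
      fun h1' => ge_of_tendsto ((hβθ.sub_const 1).mul (hβrem n))
        ((hd n).mono fun β hβ => (hβ.2.2.2 h1').le)⟩
  refine (isUnivoque_iff_exists_isForced h1 h2.le).2
    ⟨d, hbinary, hweak.isForced h1 h2 hd01 fun n h0 hcritical => ?_⟩
  obtain ⟨β, hβ, hθβ : θ < β⟩ := ((hd n).and (hFθ self_mem_nhdsWithin)).exists
  have hle : remainder θ d 1 n ≤ remainder β d 1 n :=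
    remainder_le_remainder (by linarith) (le_of_lt hθβ)
      (fun k => (hbinary.2 k).1) n
  nlinarith [hβ.2.2.1 h0, (hbinary.2 n).1, hθβ]

end Limits

theorem abs_mul_abs_sub_le (a x y : ℝ) : |a| * |x| - |y - a * x| ≤ |y| := by
  rw [← abs_mul, abs_sub_comm]
  linarith [abs_sub_abs_le_abs_sub (a * x) y]

/-- The integer sequence `v` behaves like a geometric progression of ratio `θ`: its errors
`v (k + 1) - θ * v k` are square summable with total at most `C`. -/
def IsNearGeometric (θ C : ℝ) (v : ℕ → ℤ) : Prop :=
  ∀ n, ∑ k ∈ Finset.range n, ((v (k + 1) : ℝ) - θ * v k) ^ 2 ≤ C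

namespace IsNearGeometric

variable {θ C : ℝ} {v : ℕ → ℤ}

theorem mono {C' : ℝ} (h : IsNearGeometric θ C v) (hC : C ≤ C') : IsNearGeometric θ C' v :=
  fun n => (h n).trans hC

theorem shift (h : IsNearGeometric θ C v) (m : ℕ) : IsNearGeometric θ C fun k => v (m + k) := by
  intro n
  have hsum := h (m + n)
  rw [Finset.sum_range_add] at hsum
  exact (le_add_of_nonneg_left (Finset.sum_nonneg fun _ _ => sq_nonneg _)).trans hsum

theorem tendsto_error (h : IsNearGeometric θ C v) :
    Tendsto (fun k => (v (k + 1) : ℝ) - θ * v k) atTop (𝓝 0) := by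
  have hsq := (summable_of_sum_range_le (fun _ => sq_nonneg _) h).tendsto_atTop_zero
  rw [tendsto_zero_iff_abs_tendsto_zero]
  simpa [Function.comp_def, Real.sqrt_sq_eq_abs] using (Real.continuous_sqrt.tendsto 0).comp hsq

theorem abs_error_le (h : IsNearGeometric θ C v) (k : ℕ) : |(v (k + 1) : ℝ) - θ * v k| ≤ √C :=
  Real.abs_le_sqrt <| (Finset.single_le_sum
    (f := fun k => ((v (k + 1) : ℝ) - θ * v k) ^ 2) (fun _ _ => sq_nonneg _)
    (Finset.self_mem_range_succ k)).trans (h (k + 1))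

theorem abs_succ_le (h : IsNearGeometric θ C v) (k : ℕ) :
    |(v (k + 1) : ℝ)| ≤ |θ| * |(v k : ℝ)| + √C := by
  have htri := abs_sub_abs_le_abs_sub (v (k + 1) : ℝ) (θ * v k)
  rw [abs_mul] at htri
  linarith [h.abs_error_le k]

theorem abs_le_mul_pow (h : IsNearGeometric θ C v) {K : ℝ} (hC : √C ≤ K) (h0 : |(v 0 : ℝ)| ≤ K)
    (k : ℕ) : |(v k : ℝ)| ≤ K * (|θ| + 1) ^ k := by
  induction k with
  | zero => simpa using h0
  | succ k ih =>
    have hK : 0 ≤ K := (Real.sqrt_nonneg C).trans hC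
    have hpow : 1 ≤ (|θ| + 1) ^ k := one_le_pow₀ (by linarith [abs_nonneg θ])
    calc |(v (k + 1) : ℝ)| ≤ |θ| * |(v k : ℝ)| + √C := h.abs_succ_le k
      _ ≤ |θ| * (K * (|θ| + 1) ^ k) + K * (|θ| + 1) ^ k := by
        gcongr
        exact hC.trans (le_mul_of_one_le_right hK hpow)
      _ = K * (|θ| + 1) ^ (k + 1) := by ring

theorem abs_zero_le_abs (h : IsNearGeometric θ C v) (hθ : 1 ≤ θ) (hC : √C ≤ (θ - 1) * |(v 0 : ℝ)|)
    (k : ℕ) : |(v 0 : ℝ)| ≤ |(v k : ℝ)| := by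
  induction k with
  | zero => rfl
  | succ k ih =>
    have hstep := abs_mul_abs_sub_le θ (v k) (v (k + 1))
    rw [abs_of_nonneg (by linarith : 0 ≤ θ)] at hstep
    nlinarith [h.abs_error_le k]

theorem exists_lt_abs (h : IsNearGeometric θ C v) (hθ : 1 < θ) (hv : ∃ᶠ k in atTop, v k ≠ 0)
    (L : ℝ) : ∃ k, L < |(v k : ℝ)| := by
  have hsmall : ∀ᶠ k in atTop, |(v (k + 1) : ℝ) - θ * v k| < (θ - 1) / 2 := by
    simpa using h.tendsto_error.abs.eventually_lt_const (by simpa using hθ)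
  obtain ⟨N, hN⟩ := eventually_atTop.1 hsmall
  obtain ⟨m, hm, hvm⟩ := frequently_atTop.1 hv N
  have hgrowth : ∀ j, ((1 + θ) / 2) ^ j ≤ |(v (m + j) : ℝ)| := by
    intro j
    induction j with
    | zero => simpa using (show (1 : ℝ) ≤ |(v m : ℝ)| from mod_cast Int.one_le_abs hvm)
    | succ j ih =>
      have hpow : 1 ≤ ((1 + θ) / 2) ^ j := one_le_pow₀ (by linarith)
      have hstep := abs_mul_abs_sub_le θ (v (m + j)) (v (m + j + 1))
      rw [abs_of_nonneg (by linarith : 0 ≤ θ)] at hstep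
      rw [pow_succ, ← add_assoc]
      nlinarith [hN (m + j) (by omega)]
  obtain ⟨j, hj⟩ := pow_unbounded_of_one_lt L (by linarith : 1 < (1 + θ) / 2)
  exact ⟨m + j, hj.trans_le (hgrowth j)⟩

theorem exists_lt_abs_and_abs_le (h : IsNearGeometric θ C v) (hθ : 1 < θ)
    (hv : ∃ᶠ k in atTop, v k ≠ 0) (h0 : |(v 0 : ℝ)| ≤ √C) {L : ℝ} (hL : 0 ≤ L) :
    ∃ k, L < |(v k : ℝ)| ∧ |(v k : ℝ)| ≤ θ * L + √C := by
  classical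
  have hex := h.exists_lt_abs hθ hv L
  refine ⟨Nat.find hex, Nat.find_spec hex, ?_⟩
  rcases hk : Nat.find hex with _ | k
  · nlinarith
  · have hprev := not_lt.1 (Nat.find_min hex (m := k) (by omega))
    have hstep := h.abs_succ_le k
    rw [abs_of_nonneg (by linarith : 0 ≤ θ)] at hstep
    nlinarith

end IsNearGeometric

section ReciprocalQuotient

open scoped PowerSeries

theorem norm_sub_mul_sq_add (a x y : ℂ) : ‖x - a * y‖ ^ 2 + (1 - ‖a‖ ^ 2) * ‖y‖ ^ 2 =
    ‖y - star a * x‖ ^ 2 + (1 - ‖a‖ ^ 2) * ‖x‖ ^ 2 := by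
  simp only [← Complex.normSq_eq_norm_sq, Complex.normSq_apply, Complex.sub_re, Complex.sub_im,
    Complex.mul_re, Complex.mul_im, Complex.star_def, Complex.conj_re, Complex.conj_im]
  ring

theorem sum_norm_sq_coeff_X_sub_C_mul (a : ℂ) (w : ℂ⟦X⟧) (n : ℕ) :
    ∑ k ∈ Finset.range (n + 1), ‖PowerSeries.coeff k ((PowerSeries.X - PowerSeries.C a) * w)‖ ^ 2 +
      (1 - ‖a‖ ^ 2) * ‖PowerSeries.coeff n w‖ ^ 2 = ∑ k ∈ Finset.range (n + 1),
        ‖PowerSeries.coeff k ((1 - PowerSeries.C (star a) * PowerSeries.X) * w)‖ ^ 2 := by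
  induction n with
  | zero =>
    simp only [zero_add, Finset.sum_range_one, sub_mul, map_sub, PowerSeries.coeff_C_mul, one_mul,
      mul_assoc, PowerSeries.coeff_zero_X_mul, mul_zero, sub_zero, zero_sub, norm_neg, norm_mul]
    ring
  | succ n ih =>
    rw [Finset.sum_range_succ, Finset.sum_range_succ _ (n + 1), ← ih]
    simp only [sub_mul, map_sub, PowerSeries.coeff_C_mul, one_mul, mul_assoc,
      PowerSeries.coeff_succ_X_mul]
    linear_combination norm_sub_mul_sq_add a (PowerSeries.coeff n w) (PowerSeries.coeff (n + 1) w)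

theorem sum_norm_sq_coeff_le_of_mul_eq {a : ℂ} (ha : ‖a‖ ≤ 1) {f g : ℂ⟦X⟧}
    (h : (1 - PowerSeries.C (star a) * PowerSeries.X) * g = (PowerSeries.X - PowerSeries.C a) * f)
    (n : ℕ) : ∑ k ∈ Finset.range n, ‖PowerSeries.coeff k g‖ ^ 2 ≤
      ∑ k ∈ Finset.range n, ‖PowerSeries.coeff k f‖ ^ 2 := by
  obtain ⟨w, rfl, rfl⟩ : ∃ w, f = (1 - PowerSeries.C (star a) * PowerSeries.X) * w ∧
      g = (PowerSeries.X - PowerSeries.C a) * w := by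
    have hinv := PowerSeries.mul_inv_cancel (1 - PowerSeries.C (star a) * PowerSeries.X) (by simp)
    refine ⟨(1 - PowerSeries.C (star a) * PowerSeries.X)⁻¹ * f, ?_, ?_⟩
    · rw [← mul_assoc, hinv, one_mul]
    · rw [mul_left_comm, ← h, ← mul_assoc, mul_comm _⁻¹, hinv, one_mul]
  rcases n with _ | n
  · simp
  · rw [← sum_norm_sq_coeff_X_sub_C_mul]
    have : 0 ≤ 1 - ‖a‖ ^ 2 := by nlinarith [norm_nonneg a]
    exact le_add_of_nonneg_right (by positivity)

-- Multiplication by a Blaschke product with zeros in the closed unit disc is a contraction of the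
-- Hardy space, and of each of its truncations because the product is analytic.
theorem sum_norm_sq_coeff_le_of_prod_mul_eq {R : Multiset ℂ} (hR : ∀ a ∈ R, ‖a‖ ≤ 1) {f g : ℂ⟦X⟧}
    (h : (R.map fun a => 1 - PowerSeries.C (star a) * PowerSeries.X).prod * g =
      (R.map fun a => PowerSeries.X - PowerSeries.C a).prod * f) (n : ℕ) :
    ∑ k ∈ Finset.range n, ‖PowerSeries.coeff k g‖ ^ 2 ≤
      ∑ k ∈ Finset.range n, ‖PowerSeries.coeff k f‖ ^ 2 := by
  induction R using Multiset.induction_on generalizing f with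
  | empty =>
    simp only [Multiset.map_zero, Multiset.prod_zero, one_mul] at h
    rw [h]
  | cons a R ih =>
    simp only [Multiset.map_cons, Multiset.prod_cons] at h
    set d : ℂ⟦X⟧ := 1 - PowerSeries.C (star a) * PowerSeries.X with hd
    have hinv : d * d⁻¹ = 1 := PowerSeries.mul_inv_cancel d (by simp [hd])
    have hfactor : d * (d⁻¹ * ((PowerSeries.X - PowerSeries.C a) * f)) =
        (PowerSeries.X - PowerSeries.C a) * f := by rw [← mul_assoc, hinv, one_mul]
    refine (ih (fun b hb => hR b (Multiset.mem_cons_of_mem hb)) ?_).trans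
      (sum_norm_sq_coeff_le_of_mul_eq (hR a (Multiset.mem_cons_self a R)) hfactor n)
    refine mul_left_cancel₀ (left_ne_zero_of_mul_eq_one hinv) ?_
    rw [mul_left_comm d _ (d⁻¹ * _), hfactor, ← mul_assoc, h]
    ring

theorem reverse_prod_X_sub_C {A : Type*} [CommRing A] [IsDomain A] (R : Multiset A) :
    (R.map fun a => X - C a).prod.reverse = (R.map fun a => 1 - C a * X).prod := by
  have hfactor : ∀ a : A, (X - C a).reverse = 1 - C a * X := fun a => by
    rw [sub_eq_add_neg, ← C_neg, reverse, natDegree_X_add_C, reflect_add, reflect_C]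
    simp [sub_eq_add_neg]
  induction R using Multiset.induction_on with
  | empty => simpa using reverse_C (1 : A)
  | cons a R ih => simp only [Multiset.map_cons, Multiset.prod_cons, reverse_mul_of_domain, ih,
      hfactor]

theorem map_reverse_eq_prod {P : ℤ[X]} (hP : P.Monic) {R : Multiset ℂ}
    (h : P.map (Int.castRingHom ℂ) = (R.map fun a => X - C a).prod) :
    P.reverse.map (Int.castRingHom ℂ) = (R.map fun a => 1 - C (star a) * X).prod := by
  have hreverse : P.reverse.map (Int.castRingHom ℂ) = (R.map fun a => 1 - C a * X).prod := by
    rw [← reverse_prod_X_sub_C, ← h, reverse, reverse, reflect_map, hP.natDegree_map]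
  have hconj : (P.reverse.map (Int.castRingHom ℂ)).map (starRingEnd ℂ) =
      P.reverse.map (Int.castRingHom ℂ) := by
    rw [Polynomial.map_map, RingHom.ext_int ((starRingEnd ℂ).comp _)]
  rw [← hconj, hreverse, Polynomial.map_multiset_prod, Multiset.map_map]
  simp

/-- The power series `P / P*`, where `P*` is the reversed polynomial of the monic polynomial `P`.
Its coefficients stay in the ring of those of `P` because `P*` has constant coefficient `1`. -/
noncomputable def reciprocalQuotient {A : Type*} [CommRing A] (P : A[X]) : A⟦X⟧ :=
  PowerSeries.invOfUnit (P.reverse : A⟦X⟧) 1 * P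

theorem reverse_mul_reciprocalQuotient {A : Type*} [CommRing A] {P : A[X]} (hP : P.Monic) :
    (P.reverse : A⟦X⟧) * reciprocalQuotient P = P := by
  have hconst : PowerSeries.constantCoeff (P.reverse : A⟦X⟧) = ((1 : Aˣ) : A) := by
    rw [← PowerSeries.coeff_zero_eq_constantCoeff_apply, coeff_coe, coeff_zero_reverse,
      hP.leadingCoeff, Units.val_one]
  rw [reciprocalQuotient, ← mul_assoc, PowerSeries.mul_invOfUnit _ _ hconst, one_mul]

end ReciprocalQuotient

section PisotSequences

variable {θ : ℝ}

theorem IsPisot.exists_roots (h : IsPisot θ) :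
    ∃ R : Multiset ℂ, R.Nodup ∧ (∀ a ∈ R, ‖a‖ < 1) ∧
      (minpoly ℤ θ).map (Int.castRingHom ℂ) = ((θ : ℂ) ::ₘ R |>.map fun a => X - C a).prod := by
  obtain ⟨-, hint, hconj⟩ := h
  set p := (minpoly ℚ θ).map (algebraMap ℚ ℂ) with hp
  have hpZ : (minpoly ℤ θ).map (Int.castRingHom ℂ) = p := by
    rw [hp, minpoly.isIntegrallyClosed_eq_field_fractions' ℚ hint, Polynomial.map_map,
      RingHom.ext_int ((algebraMap ℚ ℂ).comp _)]
  have hmonic : p.Monic := (minpoly.monic hint.tower_top).map _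
  have hmem : ∀ a, a ∈ p.roots ↔ aeval a (minpoly ℚ θ) = 0 := fun a => by
    rw [mem_roots hmonic.ne_zero, IsRoot.def, eval_map_algebraMap]
  have hθ : (θ : ℂ) ∈ p.roots := by
    rw [hmem, ← Complex.coe_algebraMap, aeval_algebraMap_apply, minpoly.aeval, map_zero]
  obtain ⟨R, hR⟩ := Multiset.exists_cons_of_mem hθ
  have hnodup : p.roots.Nodup := nodup_roots (minpoly.irreducible hint.tower_top).separable.map
  rw [hR, Multiset.nodup_cons] at hnodup
  refine ⟨R, hnodup.2, fun a ha => hconj a ?_ ?_, ?_⟩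
  · rw [← hmem, hR]
    exact Multiset.mem_cons_of_mem ha
  · rintro rfl
    exact hnodup.1 ha
  · rw [hpZ, ← hR]
    exact (IsAlgClosed.splits p).eq_prod_roots_of_monic hmonic

theorem coe_prod_multiset_map {ι A : Type*} [CommSemiring A] (R : Multiset ι) (f : ι → A[X]) :
    (((R.map f).prod : A[X]) : PowerSeries A) = (R.map fun i => (f i : PowerSeries A)).prod := by
  rw [← Polynomial.coeToPowerSeries.ringHom_apply, map_multiset_prod, Multiset.map_map]
  rfl

theorem exists_seq_of_add_inv_eq (hθ : 1 < θ) {m : ℤ} (hm : θ + θ⁻¹ = m) :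
    ∃ u : ℕ → ℤ, (∀ n, (u 0 : ℝ) ^ 2 + ∑ k ∈ Finset.range n, ((u (k + 1) : ℝ) - θ * u k) ^ 2 ≤
      θ ^ 2 + 3) ∧ ∀ k, u k ≠ 0 := by
  have hθ0 : 0 < θ := by linarith
  have hint : ∀ k : ℕ, ∃ z : ℤ, (z : ℝ) = θ ^ k + θ⁻¹ ^ k := by
    intro k
    induction k using Nat.twoStepInduction with
    | zero => exact ⟨2, by norm_num⟩
    | one => exact ⟨m, by rw [pow_one, pow_one, hm]⟩
    | more k ih₀ ih₁ =>
      obtain ⟨a, ha⟩ := ih₀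
      obtain ⟨b, hb⟩ := ih₁
      refine ⟨m * b - a, ?_⟩
      push_cast
      rw [ha, hb, ← hm]
      linear_combination (θ ^ k + θ⁻¹ ^ k) * mul_inv_cancel₀ hθ0.ne'
  choose u hu using hint
  refine ⟨u, fun n => ?_, fun k hk => ?_⟩
  · have hsum : ∑ k ∈ Finset.range n, ((u (k + 1) : ℝ) - θ * u k) ^ 2 =
        (θ ^ 2 - 1) * (1 - (θ⁻¹ ^ n) ^ 2) := by
      induction n with
      | zero => simp
      | succ n ih =>
        rw [Finset.sum_range_succ, ih, hu, hu]
        linear_combination (θ * θ⁻¹ - 1) * (θ⁻¹ ^ n) ^ 2 * mul_inv_cancel₀ hθ0.ne'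
    rw [hsum, hu, pow_zero, pow_zero]
    nlinarith [mul_nonneg (by nlinarith : 0 ≤ θ ^ 2 - 1) (sq_nonneg (θ⁻¹ ^ n))]
  · have hpos : 0 < (u k : ℝ) := by
      rw [hu]
      positivity
    simp [hk] at hpos

theorem prod_mul_map_reciprocalQuotient {P : ℤ[X]} (hP : P.Monic) {R : Multiset ℂ}
    (h : P.map (Int.castRingHom ℂ) = ((θ : ℂ) ::ₘ R |>.map fun a => X - C a).prod) :
    (R.map fun a => 1 - PowerSeries.C (star a) * PowerSeries.X).prod *
      ((1 - PowerSeries.C (θ : ℂ) * PowerSeries.X) *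
        PowerSeries.map (Int.castRingHom ℂ) (reciprocalQuotient P)) =
    (R.map fun a => PowerSeries.X - PowerSeries.C a).prod *
      (PowerSeries.X - PowerSeries.C (θ : ℂ)) := by
  have hmap := congrArg (PowerSeries.map (Int.castRingHom ℂ)) (reverse_mul_reciprocalQuotient hP)
  rw [map_mul, ← Polynomial.polynomial_map_coe, ← Polynomial.polynomial_map_coe,
    map_reverse_eq_prod hP h, h, coe_prod_multiset_map, coe_prod_multiset_map] at hmap
  simp only [Multiset.map_cons, Multiset.prod_cons, Polynomial.coe_sub, Polynomial.coe_mul,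
    Polynomial.coe_one, Polynomial.coe_C, Polynomial.coe_X, Complex.star_def,
    Complex.conj_ofReal] at hmap ⊢
  linear_combination hmap

theorem IsPisot.sum_reciprocalQuotient_le (h : IsPisot θ) (n : ℕ) :
    ((PowerSeries.coeff 0 (reciprocalQuotient (minpoly ℤ θ)) : ℤ) : ℝ) ^ 2 +
      ∑ k ∈ Finset.range n,
        (((PowerSeries.coeff (k + 1) (reciprocalQuotient (minpoly ℤ θ)) : ℤ) : ℝ) -
          θ * (PowerSeries.coeff k (reciprocalQuotient (minpoly ℤ θ)) : ℤ)) ^ 2 ≤ θ ^ 2 + 1 := by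
  obtain ⟨R, -, hR, hP⟩ := h.exists_roots
  have hquot := prod_mul_map_reciprocalQuotient (minpoly.monic h.2.1) hP
  set f := reciprocalQuotient (minpoly ℤ θ)
  set g : PowerSeries ℂ :=
    (1 - PowerSeries.C (θ : ℂ) * PowerSeries.X) * PowerSeries.map (Int.castRingHom ℂ) f with hg
  have hcoeff0 : PowerSeries.coeff 0 g = (((PowerSeries.coeff 0 f : ℤ) : ℝ) : ℂ) := by
    simp only [hg, sub_mul, one_mul, mul_assoc, map_sub, PowerSeries.coeff_C_mul,
      PowerSeries.coeff_zero_X_mul, PowerSeries.coeff_map, mul_zero, sub_zero, eq_intCast,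
      Complex.ofReal_intCast]
  have hcoeff : ∀ k, PowerSeries.coeff (k + 1) g =
      ((((PowerSeries.coeff (k + 1) f : ℤ) : ℝ) - θ * (PowerSeries.coeff k f : ℤ) : ℝ) : ℂ) :=
    fun k => by
      simp only [hg, sub_mul, one_mul, mul_assoc, map_sub, PowerSeries.coeff_C_mul,
        PowerSeries.coeff_succ_X_mul, PowerSeries.coeff_map, eq_intCast, Complex.ofReal_sub,
        Complex.ofReal_mul, Complex.ofReal_intCast]
  have hlinear : ∑ k ∈ Finset.range n,
      ‖PowerSeries.coeff (k + 1) (PowerSeries.X - PowerSeries.C (θ : ℂ))‖ ^ 2 ≤ 1 := by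
    simp only [map_sub, PowerSeries.coeff_X, PowerSeries.coeff_C]
    rcases n with _ | n <;> simp [Finset.sum_range_succ']
  have hle := sum_norm_sq_coeff_le_of_prod_mul_eq (fun a ha => (hR a ha).le) hquot (n + 1)
  simp only [Finset.sum_range_succ', hcoeff0, hcoeff, Complex.norm_real, Real.norm_eq_abs,
    sq_abs] at hle
  have hconst : ‖PowerSeries.coeff 0 (PowerSeries.X - PowerSeries.C (θ : ℂ))‖ ^ 2 = θ ^ 2 := by
    simp
  linarith

theorem IsPisot.inv_mem_roots (h : IsPisot θ) {R : Multiset ℂ}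
    (hP : (minpoly ℤ θ).map (Int.castRingHom ℂ) = ((θ : ℂ) ::ₘ R |>.map fun a => X - C a).prod)
    {f : ℤ[X]} (hf : (minpoly ℤ θ).reverse * f = minpoly ℤ θ) :
    ∀ z ∈ (θ : ℂ) ::ₘ R, z ≠ 0 ∧ z⁻¹ ∈ (θ : ℂ) ::ₘ R := by
  have heval : ∀ z : ℂ, z ∈ (θ : ℂ) ::ₘ R ↔ (minpoly ℤ θ).eval₂ (Int.castRingHom ℂ) z = 0 := by
    intro z
    rw [eval₂_eq_eval_map, hP, eval_multiset_prod, Multiset.prod_eq_zero_iff]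
    simp [sub_eq_zero, eq_comm]
  intro z hz
  have hz0 : z ≠ 0 := by
    rintro rfl
    have hθ0 : θ ≠ 0 := by linarith [h.1]
    rw [heval, eval₂_at_zero, eq_intCast, Int.cast_eq_zero] at hz
    refine minpoly.coeff_zero_ne_zero (h.2.1.tower_top (A := ℚ)) hθ0 ?_
    rw [minpoly.isIntegrallyClosed_eq_field_fractions' ℚ h.2.1, coeff_map, hz, map_zero]
  refine ⟨hz0, ?_⟩
  let _ := invertibleOfNonzero hz0
  rw [heval, ← invOf_eq_inv, ← hf, eval₂_mul,
    (eval₂_reverse_eq_zero_iff _ z _).2 ((heval z).1 hz), zero_mul]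

theorem IsPisot.exists_add_inv_eq (h : IsPisot θ) {f : ℤ[X]}
    (hf : (minpoly ℤ θ).reverse * f = minpoly ℤ θ) : ∃ m : ℤ, θ + θ⁻¹ = m := by
  obtain ⟨R, hnodup, hR, hP⟩ := h.exists_roots
  have hinv := h.inv_mem_roots hP hf
  have hθ := hinv θ (Multiset.mem_cons_self _ _)
  have hroot : ∀ a ∈ R, a = (θ : ℂ)⁻¹ := fun a ha => by
    obtain ⟨ha0, hainv⟩ := hinv a (Multiset.mem_cons_of_mem ha)
    refine inv_eq_iff_eq_inv.1 ((Multiset.mem_cons.1 hainv).resolve_right fun hmem => ?_)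
    have hlt := hR _ hmem
    rw [norm_inv] at hlt
    exact hlt.not_ge ((one_le_inv₀ (norm_pos_iff.2 ha0)).2 (hR a ha).le)
  have hθR : (θ : ℂ)⁻¹ ∈ R := by
    refine (Multiset.mem_cons.1 hθ.2).resolve_left fun heq => ?_
    have hinv_eq : θ⁻¹ = θ := by exact_mod_cast heq
    exact (inv_lt_one_of_one_lt₀ h.1).not_ge (hinv_eq.symm ▸ h.1.le)
  have hRs : R = {(θ : ℂ)⁻¹} := (Multiset.Nodup.ext hnodup (Multiset.nodup_singleton _)).2 fun a =>
    ⟨fun ha => Multiset.mem_singleton.2 (hroot a ha), fun ha => Multiset.mem_singleton.1 ha ▸ hθR⟩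
  have hcoeff : ((minpoly ℤ θ).coeff 1 : ℂ) = -θ - (θ : ℂ)⁻¹ := by
    simpa [hRs, sub_mul, mul_sub, coeff_X, coeff_C] using congrArg (fun p : ℂ[X] => p.coeff 1) hP
  have hreal : ((minpoly ℤ θ).coeff 1 : ℝ) = -θ - θ⁻¹ := by exact_mod_cast hcoeff
  exact ⟨-(minpoly ℤ θ).coeff 1, by push_cast; linarith⟩

theorem IsPisot.exists_isNearGeometric (h : IsPisot θ) : ∃ u : ℕ → ℤ,
    IsNearGeometric θ (θ ^ 2 + 3) u ∧ |(u 0 : ℝ)| ≤ √(θ ^ 2 + 3) ∧ ∃ᶠ k in atTop, u k ≠ 0 := by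
  obtain ⟨u, henergy, hu⟩ : ∃ u : ℕ → ℤ, (∀ n, (u 0 : ℝ) ^ 2 +
      ∑ k ∈ Finset.range n, ((u (k + 1) : ℝ) - θ * u k) ^ 2 ≤ θ ^ 2 + 3) ∧
        ∃ᶠ k in atTop, u k ≠ 0 := by
    set f := reciprocalQuotient (minpoly ℤ θ)
    by_cases hfreq : ∃ᶠ k in atTop, PowerSeries.coeff k f ≠ 0
    · exact ⟨fun k => PowerSeries.coeff k f,
        fun n => (h.sum_reciprocalQuotient_le n).trans (by linarith), hfreq⟩
    · simp only [not_frequently, not_not, eventually_atTop] at hfreq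
      obtain ⟨K, hK⟩ := hfreq
      have htrunc : ((f.trunc K : ℤ[X]) : PowerSeries ℤ) = f := by
        ext k
        rw [coeff_coe, PowerSeries.coeff_trunc, ite_eq_left_iff]
        exact fun hk => (hK k (not_lt.1 hk)).symm
      have hpoly : (minpoly ℤ θ).reverse * f.trunc K = minpoly ℤ θ := by
        apply Polynomial.coe_injective ℤ
        rw [Polynomial.coe_mul, htrunc, reverse_mul_reciprocalQuotient (minpoly.monic h.2.1)]
      obtain ⟨m, hm⟩ := h.exists_add_inv_eq hpoly
      obtain ⟨u, henergy, hu⟩ := exists_seq_of_add_inv_eq h.1 hm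
      exact ⟨u, henergy, Frequently.of_forall hu⟩
  exact ⟨u, fun n => by linarith [henergy n, sq_nonneg (u 0 : ℝ)],
    Real.abs_le_sqrt (by simpa using henergy 0), hu⟩

end PisotSequences

section Hankel

theorem abs_det_le_prod_norm_row {n : ℕ} (M : Matrix (Fin n) (Fin n) ℝ) :
    |M.det| ≤ ∏ i, ‖WithLp.toLp 2 (M i)‖ := by
  have : Fact (Module.finrank ℝ (EuclideanSpace ℝ (Fin n)) = n) := ⟨by simp⟩
  set b := EuclideanSpace.basisFun (Fin n) ℝ
  have hvolume := b.toBasis.orientation.abs_volumeForm_apply_le fun i => WithLp.toLp 2 (M i)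
  rw [Orientation.volumeForm_robust _ b rfl, Module.Basis.det_apply] at hvolume
  convert hvolume using 2
  rw [← Matrix.det_transpose]
  congr 1

/-- The Hankel matrix of order `n` of a sequence, whose vanishing determinants detect linear
recurrences. -/
def hankel {A : Type*} (v : ℕ → A) (n : ℕ) : Matrix (Fin n) (Fin n) A :=
  Matrix.of fun i j => v (i + j)

theorem abs_det_hankel_le (v : ℕ → ℝ) (θ : ℝ) (n : ℕ) :
    |(hankel v (n + 1)).det| ≤ (∑ j ∈ Finset.range (n + 1), |v j|) *
      ∏ i ∈ Finset.range n,
        √(∑ j ∈ Finset.range (n + 1), (v (i + j + 1) - θ * v (i + j)) ^ 2) := by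
  set M : Matrix (Fin (n + 1)) (Fin (n + 1)) ℝ := Matrix.of fun i j =>
    Fin.cases (v j) (fun i : Fin n => v (i + j + 1) - θ * v (i + j)) i with hM
  have hdet : (hankel v (n + 1)).det = M.det := by
    refine Matrix.det_eq_of_forall_row_eq_smul_add_pred (fun _ => θ) (fun j => ?_) fun i j => ?_
    · simp [hankel, hM]
    · simp [hankel, hM, show (i : ℕ) + 1 + j = i + j + 1 by ring]
  rw [hdet]
  refine (abs_det_le_prod_norm_row M).trans ?_
  rw [Fin.prod_univ_succ, Finset.prod_range]
  refine mul_le_mul ?_ (le_of_eq ?_) (by positivity) (by positivity)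
  · rw [EuclideanSpace.norm_eq, Real.sqrt_le_left (by positivity), Finset.sum_range]
    simp only [hM, Matrix.of_apply, Fin.cases_zero, Real.norm_eq_abs]
    exact Finset.sum_sq_le_sq_sum_of_nonneg fun _ _ => abs_nonneg _
  · refine Finset.prod_congr rfl fun i _ => ?_
    rw [EuclideanSpace.norm_eq, Finset.sum_range]
    simp [hM]

theorem tendsto_prod_range_zero {a : ℕ → ℝ} (h : Tendsto a atTop (𝓝 0)) :
    Tendsto (fun n => ∏ i ∈ Finset.range n, a i) atTop (𝓝 0) := by
  refine (summable_of_ratio_norm_eventually_le (r := 1 / 2) (by norm_num) ?_).tendsto_atTop_zero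
  have hsmall : ∀ᶠ n in atTop, ‖a n‖ < 1 / 2 := by
    simpa using h.norm.eventually_lt_const (by norm_num)
  filter_upwards [hsmall] with n hn
  rw [Finset.prod_range_succ, norm_mul, mul_comm]
  gcongr

namespace IsNearGeometric

variable {θ C : ℝ} {v : ℕ → ℤ}

theorem sum_abs_le (h : IsNearGeometric θ C v) : ∃ K, 0 ≤ K ∧
    ∀ n, ∑ j ∈ Finset.range (n + 1), |(v j : ℝ)| ≤ K * (|θ| + 2) ^ n := by
  set K := max √C |(v 0 : ℝ)|
  have hK : 0 ≤ K := (Real.sqrt_nonneg C).trans (le_max_left _ _)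
  refine ⟨K, hK, fun n => ?_⟩
  induction n with
  | zero => simp [K]
  | succ n ih =>
    have hterm : |(v (n + 1) : ℝ)| ≤ K * ((|θ| + 2) ^ n * (|θ| + 1)) := by
      refine (h.abs_le_mul_pow (le_max_left _ _) (le_max_right _ _) _).trans ?_
      rw [pow_succ]
      gcongr
      linarith
    rw [Finset.sum_range_succ]
    linear_combination ih + hterm

theorem sqrt_sum_error_le (h : IsNearGeometric θ C v) : ∃ a : ℕ → ℝ, Tendsto a atTop (𝓝 0) ∧
    ∀ i n, √(∑ j ∈ Finset.range n, ((v (i + j + 1) : ℝ) - θ * v (i + j)) ^ 2) ≤ a i := by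
  set e : ℕ → ℝ := fun k => ((v (k + 1) : ℝ) - θ * v k) ^ 2
  have hsummable : Summable e := summable_of_sum_range_le (fun _ => sq_nonneg _) h
  refine ⟨fun i => √(∑' j, e (j + i)), ?_, fun i n => Real.sqrt_le_sqrt ?_⟩
  · simpa [Function.comp_def] using
      (Real.continuous_sqrt.tendsto 0).comp (tendsto_sum_nat_add e)
  · simp_rw [add_comm i]
    exact ((summable_nat_add_iff i).2 hsummable).sum_le_tsum _ fun _ _ => sq_nonneg _

theorem eventually_det_hankel_eq_zero (h : IsNearGeometric θ C v) :
    ∀ᶠ n in atTop, (hankel v n).det = 0 := by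
  obtain ⟨K, hK, hsum⟩ := h.sum_abs_le
  obtain ⟨a, ha, herror⟩ := h.sqrt_sum_error_le
  have hbound : ∀ n, |((hankel v (n + 1)).det : ℝ)| ≤
      K * ∏ i ∈ Finset.range n, ((|θ| + 2) * a i) := fun n => by
    rw [Int.cast_det]
    calc |(hankel (fun k => (v k : ℝ)) (n + 1)).det|
        ≤ _ := abs_det_hankel_le _ θ n
      _ ≤ K * (|θ| + 2) ^ n * ∏ i ∈ Finset.range n, a i :=
        mul_le_mul (hsum n) (Finset.prod_le_prod (by intros; positivity) fun i _ => herror i _)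
          (by positivity) (by positivity)
      _ = _ := by rw [Finset.prod_mul_distrib, Finset.prod_const, Finset.card_range, mul_assoc]
  have hlim : Tendsto (fun n => K * ∏ i ∈ Finset.range n, ((|θ| + 2) * a i)) atTop (𝓝 0) := by
    simpa using (tendsto_prod_range_zero (by simpa using ha.const_mul (|θ| + 2))).const_mul K
  rw [← map_add_atTop_eq_nat 1, eventually_map]
  filter_upwards [hlim.eventually_lt_const one_pos] with n hn
  exact Int.abs_lt_one_iff.1 (by exact_mod_cast (hbound n).trans_lt hn)

end IsNearGeometric

end Hankel

section Recurrences

variable {A : Type*} [CommRing A]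

/-- The shift `(S v) k = v (k + 1)` on sequences. A sequence `v` satisfies the linear recurrence
with characteristic polynomial `p` when `aeval (seqShift A) p v = 0`. -/
def seqShift (A : Type*) [CommRing A] : Module.End A (ℕ → A) :=
  LinearMap.funLeft A A Nat.succ

theorem seqShift_pow_apply (v : ℕ → A) (i k : ℕ) : (seqShift A ^ i) v k = v (k + i) := by
  induction i generalizing k with
  | zero => simp
  | succ i ih =>
    rw [pow_succ', Module.End.mul_apply]
    exact (ih (k + 1)).trans (congrArg v (by omega))

theorem aeval_seqShift_apply (p : A[X]) (v : ℕ → A) (k : ℕ) :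
    aeval (seqShift A) p v k = ∑ i ∈ Finset.range (p.natDegree + 1), p.coeff i * v (k + i) := by
  simp [aeval_eq_sum_range, seqShift_pow_apply]

theorem aeval_seqShift_X_sub_C_apply (a : A) (v : ℕ → A) (k : ℕ) :
    aeval (seqShift A) (X - C a) v k = v (k + 1) - a * v k := by
  rw [map_sub, aeval_X, aeval_C]
  rfl

theorem aeval_seqShift_add (p : A[X]) (v : ℕ → A) (m k : ℕ) :
    aeval (seqShift A) p (fun i => v (m + i)) k = aeval (seqShift A) p v (m + k) := by
  simp only [aeval_seqShift_apply, add_assoc]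

theorem aeval_seqShift_map {B : Type*} [CommRing B] (f : A →+* B) (p : A[X]) (v : ℕ → A) (k : ℕ) :
    aeval (seqShift B) (p.map f) (fun i => f (v i)) k = f (aeval (seqShift A) p v k) := by
  induction p using Polynomial.induction_on' with
  | add p q hp hq =>
    simp only [Polynomial.map_add, map_add, LinearMap.add_apply, Pi.add_apply, hp, hq]
  | monomial n a =>
    simp only [map_monomial, aeval_monomial, Module.End.mul_apply, Module.algebraMap_end_apply,
      Pi.smul_apply, seqShift_pow_apply, smul_eq_mul, map_mul]

theorem exists_aeval_seqShift_eq_zero_of_det_hankel [IsDomain A] {v : ℕ → A} {n : ℕ}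
    (h : (hankel v n).det = 0) : ∃ p : A[X], p ≠ 0 ∧ p.natDegree < n ∧
      ∀ i < n, aeval (seqShift A) p v i = 0 := by
  obtain ⟨c, hc, hmul⟩ := Matrix.exists_mulVec_eq_zero_iff.2 h
  have hp : (∑ j : Fin n, C (c j) * X ^ (j : ℕ)) ≠ 0 := fun hzero => hc <| funext fun j => by
    simpa [coeff_C_mul, coeff_X_pow, Fin.val_inj] using congrArg (fun p => p.coeff j) hzero
  refine ⟨_, hp, (natDegree_lt_iff_degree_lt hp).2 (degree_sum_fin_lt c), fun i hi => ?_⟩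
  rw [map_sum, LinearMap.sum_apply, Finset.sum_apply]
  refine Eq.trans ?_ (congrFun hmul ⟨i, hi⟩)
  refine Finset.sum_congr rfl fun j _ => ?_
  rw [map_mul, map_pow, aeval_X, aeval_C, Module.End.mul_apply, Module.algebraMap_end_apply,
    Pi.smul_apply, seqShift_pow_apply, smul_eq_mul, mul_comm]
  rfl

-- Among the recurrences `p k` valid on initial segments, one of least degree is valid forever: if
-- `e = p k (S) v` first fails to vanish at `j`, then a recurrence `q` valid up to `j` reads off
-- a nonzero multiple of `e j` from `q (S) e = p k (S) (q (S) v)`, whose value there is zero.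
theorem exists_aeval_seqShift_eq_zero [IsDomain A] {v : ℕ → A}
    (h : ∀ᶠ n in atTop, (hankel v n).det = 0) :
    ∃ p : A[X], p ≠ 0 ∧ aeval (seqShift A) p v = 0 := by
  classical
  obtain ⟨N, hN⟩ := eventually_atTop.1 h
  choose p hp0 hdeg hp using fun k => exists_aeval_seqShift_eq_zero_of_det_hankel
    (hN (N + k) (Nat.le_add_right N k))
  set k := Function.argmin fun k => (p k).natDegree
  have hmin : ∀ l, (p k).natDegree ≤ (p l).natDegree :=
    fun l => Function.argmin_le (fun k => (p k).natDegree) l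
  refine ⟨p k, hp0 k, ?_⟩
  by_contra hne
  set e := aeval (seqShift A) (p k) v with he
  have hex : ∃ j, e j ≠ 0 := Function.ne_iff.1 hne
  set j := Nat.find hex
  have hj : ∀ i < j, e i = 0 := fun i hi => not_not.1 (Nat.find_min hex hi)
  have hNj : N + k ≤ j := not_lt.1 fun hlt => Nat.find_spec hex (hp k j hlt)
  obtain ⟨l, hl⟩ : ∃ l, N + l = j + 1 := ⟨j + 1 - N, by omega⟩
  have hlj : (p l).natDegree ≤ j := by have := hdeg l; omega
  have hzero : aeval (seqShift A) (p l) e (j - (p l).natDegree) = 0 := by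
    rw [he, ← Module.End.mul_apply, ← map_mul, mul_comm, map_mul, Module.End.mul_apply,
      aeval_seqShift_apply]
    refine Finset.sum_eq_zero fun i hi => ?_
    have hi' := Finset.mem_range.1 hi
    rw [hp l _ (by have := hmin l; omega), mul_zero]
  have hlead : aeval (seqShift A) (p l) e (j - (p l).natDegree) = (p l).leadingCoeff * e j := by
    rw [aeval_seqShift_apply, Finset.sum_range_succ, Nat.sub_add_cancel hlj, Finset.sum_eq_zero
      fun i hi => ?_, zero_add, leadingCoeff]
    have hi' := Finset.mem_range.1 hi
    rw [hj _ (by omega), mul_zero]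
  exact mul_ne_zero (leadingCoeff_ne_zero.2 (hp0 l)) (Nat.find_spec hex) (hlead ▸ hzero)

theorem eq_zero_of_aeval_seqShift_eq_zero [IsDomain A] {p : A[X]} (hp : p ≠ 0) {v : ℕ → A}
    (hv : aeval (seqShift A) p v = 0) (h0 : ∀ i < p.natDegree, v i = 0) : v = 0 := by
  funext k
  induction k using Nat.strong_induction_on with
  | _ k ih =>
    rcases lt_or_ge k p.natDegree with hk | hk
    · exact h0 k hk
    · have hrec := congrFun hv (k - p.natDegree)
      rw [aeval_seqShift_apply, Finset.sum_range_succ, Nat.sub_add_cancel hk, Finset.sum_eq_zero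
        fun i hi => ?_, zero_add] at hrec
      · exact (mul_eq_zero.1 hrec).resolve_left (leadingCoeff_ne_zero.2 hp)
      · have hi' := Finset.mem_range.1 hi
        rw [ih _ (by omega), Pi.zero_apply, mul_zero]

theorem coe_aeval_restrict {M : Type*} [AddCommGroup M] [Module A M] {f : Module.End A M}
    {W : Submodule A M} (hW : ∀ x ∈ W, f x ∈ W) (p : A[X]) (x : W) :
    (aeval (f.restrict hW) p x : M) = aeval f p x := by
  simp only [aeval_eq_sum_range, LinearMap.sum_apply, LinearMap.smul_apply, Submodule.coe_sum,
    Submodule.coe_smul, Module.End.pow_restrict _ hW, LinearMap.coe_restrict_apply]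

-- The solutions of the recurrence form a finitely generated module, so the shift is integral on it.
theorem exists_monic_aeval_seqShift_eq_zero [IsDomain A] [IsNoetherianRing A] {v : ℕ → A}
    {p : A[X]} (hp : p ≠ 0) (hv : aeval (seqShift A) p v = 0) :
    ∃ r : A[X], r.Monic ∧ aeval (seqShift A) r v = 0 := by
  set W := LinearMap.ker (aeval (seqShift A) p)
  have hcomm : aeval (seqShift A) p * seqShift A = seqShift A * aeval (seqShift A) p := by
    simpa using congrArg (aeval (seqShift A)) (mul_comm p X)
  have hW : ∀ w ∈ W, seqShift A w ∈ W := fun w hw => by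
    rw [LinearMap.mem_ker] at hw ⊢
    rw [← Module.End.mul_apply, hcomm, Module.End.mul_apply, hw, map_zero]
  let initial : W →ₗ[A] Fin p.natDegree → A := LinearMap.funLeft A A Fin.val ∘ₗ W.subtype
  have hinitial : Function.Injective initial := by
    rw [injective_iff_map_eq_zero]
    exact fun w hw => Subtype.ext <| eq_zero_of_aeval_seqShift_eq_zero hp w.2
      fun i hi => congrFun hw ⟨i, hi⟩
  have : Module.Finite A W := Module.Finite.of_injective initial hinitial
  obtain ⟨r, hr, hrW⟩ := LinearMap.exists_monic_and_aeval_eq_zero A ((seqShift A).restrict hW)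
  refine ⟨r, hr, ?_⟩
  rw [← coe_aeval_restrict hW r ⟨v, hv⟩, hrW]
  rfl

end Recurrences

section PisotCriterion

theorem tendsto_aeval_seqShift {A : Type*} [CommRing A] [TopologicalSpace A] [IsTopologicalRing A]
    {v : ℕ → A} (hv : Tendsto v atTop (𝓝 0)) (p : A[X]) :
    Tendsto (aeval (seqShift A) p v) atTop (𝓝 0) := by
  simp_rw [funext (aeval_seqShift_apply p v)]
  rw [← Finset.sum_const_zero (s := Finset.range (p.natDegree + 1))]
  refine tendsto_finsetSum _ fun i _ => ?_
  simpa using ((tendsto_add_atTop_iff_nat i).2 hv).const_mul (p.coeff i)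

theorem tendsto_aeval_seqShift_of_isRoot {A : Type*} [CommRing A] [TopologicalSpace A]
    [IsTopologicalRing A] {v : ℕ → A} {a : A}
    (ha : Tendsto (aeval (seqShift A) (X - C a) v) atTop (𝓝 0)) {p : A[X]} (hp : p.IsRoot a) :
    Tendsto (aeval (seqShift A) p v) atTop (𝓝 0) := by
  obtain ⟨q, rfl⟩ := dvd_iff_isRoot.2 hp
  rw [mul_comm, map_mul, Module.End.mul_apply]
  exact tendsto_aeval_seqShift ha q

theorem isRoot_of_tendsto_aeval_seqShift {K : Type*} [Field K] [TopologicalSpace K]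
    [IsTopologicalRing K] {v : ℕ → K} {a : K}
    (ha : Tendsto (aeval (seqShift K) (X - C a) v) atTop (𝓝 0)) (hv : ¬ Tendsto v atTop (𝓝 0))
    {p : K[X]} (hp : Tendsto (aeval (seqShift K) p v) atTop (𝓝 0)) : p.IsRoot a := by
  by_contra hne
  refine hv ?_
  have hconst : Tendsto (aeval (seqShift K) (C (p.eval a)) v) atTop (𝓝 0) := by
    have hroot : (p - C (p.eval a)).IsRoot a := by simp
    have hsub := hp.sub (tendsto_aeval_seqShift_of_isRoot ha hroot)
    rw [sub_zero] at hsub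
    refine hsub.congr fun k => ?_
    rw [← Pi.sub_apply, ← LinearMap.sub_apply, ← map_sub, sub_sub_cancel]
  have hscale := hconst.const_mul (p.eval a)⁻¹
  rw [mul_zero] at hscale
  refine hscale.congr fun k => ?_
  rw [aeval_C, Module.algebraMap_end_apply, Pi.smul_apply, smul_eq_mul, inv_mul_cancel_left₀ hne]

theorem aeval_seqShift_divByMonic_apply {A : Type*} [CommRing A] {v : ℕ → A} {p : A[X]}
    (hv : aeval (seqShift A) p v = 0) {a : A} (ha : p.IsRoot a) (k : ℕ) :
    aeval (seqShift A) (p /ₘ (X - C a)) v k = aeval (seqShift A) (p /ₘ (X - C a)) v 0 * a ^ k := by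
  induction k with
  | zero => simp
  | succ k ih =>
    rw [← mul_divByMonic_eq_iff_isRoot.2 ha, map_mul, Module.End.mul_apply] at hv
    have hk := congrFun hv k
    rw [aeval_seqShift_X_sub_C_apply, Pi.zero_apply, sub_eq_zero] at hk
    rw [hk, ih, pow_succ', mul_left_comm]

section Conjugates

variable {K E : Type*} [Field K] {f : K[X]}

-- The coefficient of the geometric sequence attached to a root is a fixed polynomial in that root.
theorem aeval_seqShift_divByMonic_eq_zero_iff [Field E] [Algebra K E] (hf : Irreducible f)
    {x y : E} (hx : aeval x f = 0) (hy : aeval y f = 0) (v : ℕ → K) (k : ℕ) :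
    aeval (seqShift E) (f.map (algebraMap K E) /ₘ (X - C x)) (fun i => algebraMap K E (v i)) k = 0 ↔
      aeval (seqShift E) (f.map (algebraMap K E) /ₘ (X - C y)) (fun i => algebraMap K E (v i)) k
        = 0 := by
  have := Fact.mk hf
  have huniversal : ∀ z : E, aeval z f = 0 →
      (aeval (seqShift E) (f.map (algebraMap K E) /ₘ (X - C z)) (fun i => algebraMap K E (v i)) k
        = 0 ↔ aeval (seqShift (AdjoinRoot f))
          (f.map (algebraMap K (AdjoinRoot f)) /ₘ (X - C (AdjoinRoot.root f)))
            (fun i => algebraMap K (AdjoinRoot f) (v i)) k = 0) := by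
    intro z hz
    set σ : AdjoinRoot f →+* E := AdjoinRoot.lift (algebraMap K E) z hz
    have hσ : σ.comp (algebraMap K (AdjoinRoot f)) = algebraMap K E :=
      AdjoinRoot.lift_comp_of hz
    have hσ_root : σ (AdjoinRoot.root f) = z := AdjoinRoot.lift_root hz
    rw [← map_eq_zero σ, ← aeval_seqShift_map, map_divByMonic _ (monic_X_sub_C _),
      Polynomial.map_map, Polynomial.map_sub, map_X, map_C, hσ, hσ_root]
    simp only [← RingHom.comp_apply, hσ]
  rw [huniversal x hx, huniversal y hy]

theorem norm_lt_one_of_aeval_seqShift_eq_zero [PerfectField K] [NormedField E] [Algebra K E]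
    (hf : Irreducible f) {v : ℕ → K} (hv : aeval (seqShift K) f v = 0) {x y : E}
    (hx : aeval x f = 0) (hy : aeval y f = 0) (hxy : x ≠ y)
    (hlim : Tendsto (aeval (seqShift E) (X - C x) fun i => algebraMap K E (v i)) atTop (𝓝 0))
    (hnot : ¬ Tendsto (fun i => algebraMap K E (v i)) atTop (𝓝 0)) : ‖y‖ < 1 := by
  set g := f.map (algebraMap K E) with hg
  set w : ℕ → E := fun i => algebraMap K E (v i)
  have hroot : ∀ {z : E}, aeval z f = 0 → g.IsRoot z := fun hz => by
    rwa [hg, IsRoot.def, eval_map_algebraMap]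
  have hw : aeval (seqShift E) g w = 0 := funext fun k => by
    rw [hg, aeval_seqShift_map, hv, Pi.zero_apply, map_zero, Pi.zero_apply]
  have hcoeffx : aeval (seqShift E) (g /ₘ (X - C x)) w 0 ≠ 0 := fun hzero => by
    have hdvd : (X - C x) * (X - C x) ∣ g := by
      rw [← mul_divByMonic_eq_iff_isRoot.2 (hroot hx)]
      refine mul_dvd_mul_left _ (dvd_iff_isRoot.2 (isRoot_of_tendsto_aeval_seqShift hlim hnot ?_))
      refine tendsto_const_nhds.congr fun k => ?_
      rw [aeval_seqShift_divByMonic_apply hw (hroot hx), hzero, zero_mul]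
    exact not_isUnit_X_sub_C x
      ((PerfectField.separable_of_irreducible hf).map.squarefree _ hdvd)
  have hcoeffy : aeval (seqShift E) (g /ₘ (X - C y)) w 0 ≠ 0 :=
    mt (aeval_seqShift_divByMonic_eq_zero_iff hf hy hx v 0).1 hcoeffx
  have hxroot : (g /ₘ (X - C y)).IsRoot x := by
    have heval := hroot hx
    rw [← mul_divByMonic_eq_iff_isRoot.2 (hroot hy), root_mul, root_X_sub_C] at heval
    exact heval.resolve_left hxy.symm
  have hpow := (tendsto_aeval_seqShift_of_isRoot hlim hxroot).const_mul
    (aeval (seqShift E) (g /ₘ (X - C y)) w 0)⁻¹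
  rw [mul_zero] at hpow
  refine tendsto_pow_atTop_nhds_zero_iff_norm_lt_one.1 (hpow.congr fun k => ?_)
  rw [aeval_seqShift_divByMonic_apply hw (hroot hy) k, inv_mul_cancel_left₀ hcoeffy]

end Conjugates

theorem eventually_eq_zero_of_tendsto_intCast {v : ℕ → ℤ}
    (h : Tendsto (fun k => (v k : ℂ)) atTop (𝓝 0)) : ∀ᶠ k in atTop, v k = 0 := by
  filter_upwards [(tendsto_zero_iff_norm_tendsto_zero.1 h).eventually_lt_const one_pos] with k hk
  rw [Complex.norm_intCast] at hk
  exact Int.abs_lt_one_iff.1 (by exact_mod_cast hk)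

namespace IsNearGeometric

variable {θ C : ℝ} {v : ℕ → ℤ}

theorem tendsto_aeval_seqShift_X_sub_C (h : IsNearGeometric θ C v) :
    Tendsto (aeval (seqShift ℂ) (X - Polynomial.C (θ : ℂ)) fun k => (v k : ℂ)) atTop (𝓝 0) := by
  have hcast := (Complex.continuous_ofReal.tendsto 0).comp h.tendsto_error
  rw [Complex.ofReal_zero] at hcast
  refine hcast.congr fun k => ?_
  rw [aeval_seqShift_X_sub_C_apply]
  simp only [Function.comp_apply, Complex.ofReal_sub, Complex.ofReal_mul, Complex.ofReal_intCast]

theorem eventually_aeval_seqShift_eq_zero (h : IsNearGeometric θ C v) {p : ℤ[X]}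
    (hp : aeval θ p = 0) : ∀ᶠ k in atTop, aeval (seqShift ℤ) p v k = 0 := by
  refine eventually_eq_zero_of_tendsto_intCast ?_
  have hroot : (p.map (Int.castRingHom ℂ)).IsRoot (θ : ℂ) := by
    rw [IsRoot.def, ← algebraMap_int_eq, eval_map_algebraMap, ← Complex.coe_algebraMap,
      aeval_algebraMap_apply, hp, map_zero]
  refine (tendsto_aeval_seqShift_of_isRoot h.tendsto_aeval_seqShift_X_sub_C hroot).congr fun k => ?_
  exact aeval_seqShift_map (Int.castRingHom ℂ) p v k

theorem isIntegral (h : IsNearGeometric θ C v) (hv : ∃ᶠ k in atTop, v k ≠ 0) : IsIntegral ℤ θ := by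
  obtain ⟨p, hp, hpv⟩ := exists_aeval_seqShift_eq_zero h.eventually_det_hankel_eq_zero
  obtain ⟨r, hr, hrv⟩ := exists_monic_aeval_seqShift_eq_zero hp hpv
  have hzero : aeval (seqShift ℂ) (r.map (Int.castRingHom ℂ)) (fun k => (v k : ℂ)) = 0 :=
    funext fun k => (aeval_seqShift_map (Int.castRingHom ℂ) r v k).trans (by simp [hrv])
  have hroot := isRoot_of_tendsto_aeval_seqShift (p := r.map (Int.castRingHom ℂ))
    h.tendsto_aeval_seqShift_X_sub_C
    (fun hlim => hv ((eventually_eq_zero_of_tendsto_intCast hlim).mono fun _ => not_not_intro))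
    (by rw [hzero]; exact tendsto_const_nhds)
  rw [IsRoot.def, ← algebraMap_int_eq, eval_map_algebraMap] at hroot
  exact (isIntegral_algebraMap_iff (B := ℂ) Complex.ofReal_injective).1 ⟨r, hr, hroot⟩

theorem isPisot (h : IsNearGeometric θ C v) (hθ : 1 < θ) (hv : ∃ᶠ k in atTop, v k ≠ 0) :
    IsPisot θ := by
  have hint := h.isIntegral hv
  refine ⟨hθ, hint, fun z hz hzθ => ?_⟩
  obtain ⟨m, hm⟩ := eventually_atTop.1
    (h.eventually_aeval_seqShift_eq_zero (minpoly.aeval ℤ θ))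
  set u : ℕ → ℤ := fun k => v (m + k)
  have hu : IsNearGeometric θ C u := h.shift m
  have huv : aeval (seqShift ℤ) (minpoly ℤ θ) u = 0 := funext fun k => by
    rw [aeval_seqShift_add, hm _ (Nat.le_add_right m k), Pi.zero_apply]
  have huQ : aeval (seqShift ℚ) (minpoly ℚ θ) (fun k => (u k : ℚ)) = 0 := funext fun k => by
    rw [minpoly.isIntegrallyClosed_eq_field_fractions' ℚ hint]
    exact (aeval_seqShift_map (algebraMap ℤ ℚ) _ u k).trans (by simp [huv])
  have hθroot : aeval (θ : ℂ) (minpoly ℚ θ) = 0 := by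
    rw [← Complex.coe_algebraMap, aeval_algebraMap_apply, minpoly.aeval, map_zero]
  refine norm_lt_one_of_aeval_seqShift_eq_zero (minpoly.irreducible hint.tower_top) huQ hθroot hz
    hzθ.symm (by simpa using hu.tendsto_aeval_seqShift_X_sub_C) fun hlim => hv ?_
  obtain ⟨n, hn⟩ := eventually_atTop.1
    (eventually_eq_zero_of_tendsto_intCast (v := u) (by simpa using hlim))
  exact eventually_atTop.2 ⟨m + n, fun k hk => by
    simpa [u, show m + (k - m) = k by omega] using hn (k - m) (by omega)⟩

end IsNearGeometric

end PisotCriterion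

section Closure

theorem IsPisot.exists_isNearGeometric_lt_abs_zero {β C L M : ℝ} (h : IsPisot β) (hβ : β ≤ M)
    (hC : β ^ 2 + 3 ≤ C) (hL : 0 ≤ L) : ∃ u : ℕ → ℤ,
      IsNearGeometric β C u ∧ L < |(u 0 : ℝ)| ∧ |(u 0 : ℝ)| ≤ M * L + √C := by
  obtain ⟨v, hv, hv0, hfreq⟩ := h.exists_isNearGeometric
  obtain ⟨k, hk, hk'⟩ := (hv.mono hC).exists_lt_abs_and_abs_le h.1 hfreq
    (hv0.trans (Real.sqrt_le_sqrt hC)) hL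
  exact ⟨fun i => v (k + i), (hv.mono hC).shift k, hk, hk'.trans (by gcongr)⟩

theorem exists_isNearGeometric_limit {θ C K M : ℝ} {F : Ultrafilter ℝ} (hF : ↑F ≤ 𝓝 θ)
    (hM : ∀ᶠ β in F, |β| ≤ M) (hCK : √C ≤ K) {u : ℝ → ℕ → ℤ}
    (hu : ∀ᶠ β in F, IsNearGeometric β C (u β)) (hu0 : ∀ᶠ β in F, |(u β 0 : ℝ)| ≤ K) :
    ∃ v, IsNearGeometric θ C v ∧ ∀ᶠ β in F, u β 0 = v 0 := by
  have hfinite : ∀ k : ℕ, {z : ℤ | |(z : ℝ)| ≤ K * (M + 1) ^ k}.Finite := fun k =>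
    (Set.finite_Icc ⌈-(K * (M + 1) ^ k)⌉ ⌊K * (M + 1) ^ k⌋).subset fun z hz =>
      ⟨Int.ceil_le.2 (abs_le.1 hz).1, Int.le_floor.2 (abs_le.1 hz).2⟩
  obtain ⟨v, hv⟩ := exists_forall_eventually_eq_of_finite F hfinite fun k => by
    filter_upwards [hM, hu, hu0] with β hβM hβ hβ0
    have hK : 0 ≤ K := (Real.sqrt_nonneg C).trans hCK
    exact (hβ.abs_le_mul_pow hCK hβ0 k).trans (by gcongr)
  refine ⟨v, fun n => ?_, (hv 1).mono fun β hβ => hβ 0 one_pos⟩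
  have hlim : Tendsto (fun β => ∑ k ∈ Finset.range n, ((v (k + 1) : ℝ) - β * v k) ^ 2) F
      (𝓝 (∑ k ∈ Finset.range n, ((v (k + 1) : ℝ) - θ * v k) ^ 2)) :=
    (Continuous.tendsto (by fun_prop) θ).mono_left hF
  refine le_of_tendsto hlim ?_
  filter_upwards [hu, hv (n + 1)] with β hβ hprefix
  refine (Finset.sum_congr rfl fun k hk => ?_).trans_le (hβ n)
  have hkn := Finset.mem_range.1 hk
  rw [hprefix k (by omega), hprefix (k + 1) (by omega)]

theorem isPisot_of_mem_closure {θ : ℝ} (h1 : 1 < θ) (hθ : θ ∈ closure {β | IsPisot β}) :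
    IsPisot θ := by
  obtain ⟨F, hFPisot, hFθ⟩ := mem_closure_iff_ultrafilter.1 hθ
  set M := θ + 1
  set C := M ^ 2 + 3
  set L := √C / (θ - 1)
  have hL : 0 ≤ L := div_nonneg (Real.sqrt_nonneg C) (by linarith)
  have hlt : ∀ᶠ β in F, β < M := hFθ (Iio_mem_nhds (by linarith))
  have hexists : ∀ᶠ β in F, ∃ u : ℕ → ℤ,
      IsNearGeometric β C u ∧ L < |(u 0 : ℝ)| ∧ |(u 0 : ℝ)| ≤ M * L + √C := by
    filter_upwards [hFPisot, hlt] with β hβ hβM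
    exact hβ.exists_isNearGeometric_lt_abs_zero hβM.le (by nlinarith [hβ.1]) hL
  obtain ⟨u, hu⟩ := hexists.choice
  have hM : ∀ᶠ β in F, |β| ≤ M := by
    filter_upwards [hFPisot, hlt] with β hβ hβM
    rw [abs_of_pos (by linarith [hβ.1])]
    exact hβM.le
  obtain ⟨v, hv, hv0⟩ := exists_isNearGeometric_limit hFθ hM
    (le_add_of_nonneg_left (by positivity)) (hu.mono fun _ h => h.1) (hu.mono fun _ h => h.2.2)
  have hLv : L < |(v 0 : ℝ)| := by
    obtain ⟨β, hβ, hβ0⟩ := (hu.and hv0).exists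
    exact hβ0 ▸ hβ.2.1
  have hlarge : √C ≤ (θ - 1) * |(v 0 : ℝ)| := (div_le_iff₀' (by linarith)).1 hLv.le
  refine hv.isPisot h1 (Frequently.of_forall fun k hk => ?_)
  have hle := hv.abs_zero_le_abs h1.le hlarge k
  rw [hk, Int.cast_zero, abs_zero] at hle
  linarith

end Closure

section Example

theorem norm_lt_one_of_quadratic {a b : ℝ} {z : ℂ} (hab : a ^ 2 < 4 * b) (hb : b < 1)
    (hz : z ^ 2 + a * z + b = 0) : ‖z‖ < 1 := by
  have hre := congrArg Complex.re hz
  have him := congrArg Complex.im hz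
  simp only [pow_two, Complex.add_re, Complex.add_im, Complex.mul_re, Complex.mul_im,
    Complex.ofReal_re, Complex.ofReal_im, Complex.zero_re, Complex.zero_im] at hre him
  have hsq : ‖z‖ ^ 2 = b := by
    rw [← Complex.normSq_eq_norm_sq, Complex.normSq_apply]
    have hprod : z.im * (2 * z.re + a) = 0 := by linear_combination him
    rcases mul_eq_zero.1 hprod with hreal | haxis
    · rw [hreal] at hre
      nlinarith [sq_nonneg (2 * z.re + a)]
    · linear_combination z.re * haxis - hre
  exact (sq_lt_one_iff₀ (norm_nonneg z)).1 (hsq ▸ hb)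

theorem norm_lt_one_of_quartic {x y : ℝ} {z : ℂ} (hx1 : 1.9 < x) (hx2 : x < 1.91)
    (hy1 : 0.66 < y) (hy2 : y < 0.68) (hx : x ^ 4 - x ^ 3 - 2 * x ^ 2 + 1 = 0)
    (hy : y ^ 4 - y ^ 3 - 2 * y ^ 2 + 1 = 0) (hz : z ^ 4 - z ^ 3 - 2 * z ^ 2 + 1 = 0)
    (hzx : z ≠ x) : ‖z‖ < 1 := by
  have hcubic : y ^ 3 + (x - 1) * y ^ 2 + (x ^ 2 - x - 2) * y + (x ^ 3 - x ^ 2 - 2 * x) = 0 := by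
    refine (mul_eq_zero.1 (?_ : (y - x) * _ = 0)).resolve_left (by linarith)
    linear_combination hy - hx
  have hxC : (x : ℂ) ^ 4 - x ^ 3 - 2 * x ^ 2 + 1 = 0 := by exact_mod_cast hx
  have hcubicC : (y : ℂ) ^ 3 + (x - 1) * y ^ 2 + (x ^ 2 - x - 2) * y
      + (x ^ 3 - x ^ 2 - 2 * x) = 0 := by exact_mod_cast hcubic
  have hfactor : (z - x) * ((z - y) * (z ^ 2 + (x + y - 1 : ℝ) * z
      + (x ^ 2 + x * y + y ^ 2 - x - y - 2 : ℝ))) = 0 := by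
    push_cast
    linear_combination hz - hxC - (z - x) * hcubicC
  rcases mul_eq_zero.1 ((mul_eq_zero.1 hfactor).resolve_left (sub_ne_zero.2 hzx)) with hzy | hquad
  · rw [sub_eq_zero.1 hzy, Complex.norm_real, Real.norm_eq_abs, abs_of_pos (by linarith)]
    linarith
  · exact norm_lt_one_of_quadratic (by nlinarith) (by nlinarith) hquad

theorem isPisot_of_quartic {x y : ℝ} (hx1 : 1.9 < x) (hx2 : x < 1.91) (hy1 : 0.66 < y)
    (hy2 : y < 0.68) (hx : x ^ 4 - x ^ 3 - 2 * x ^ 2 + 1 = 0)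
    (hy : y ^ 4 - y ^ 3 - 2 * y ^ 2 + 1 = 0) : IsPisot x := by
  refine ⟨by linarith, ⟨X ^ 4 - X ^ 3 - 2 * X ^ 2 + 1, by monicity!, ?_⟩, fun z hz hzx => ?_⟩
  · simpa [eval₂_add, eval₂_sub, eval₂_mul] using hx
  · have hdvd : minpoly ℚ x ∣ X ^ 4 - X ^ 3 - C 2 * X ^ 2 + 1 :=
      minpoly.dvd ℚ x (by simpa using hx)
    refine norm_lt_one_of_quartic hx1 hx2 hy1 hy2 hx hy ?_ hzx
    simpa using aeval_eq_zero_of_dvd_aeval_eq_zero hdvd hz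

/-- The digit sequence `11(10)^∞`. It expands `1` in base `x > 1` exactly when
`x ^ 4 - x ^ 3 - 2 * x ^ 2 + 1 = 0`, which has a Pisot root near `1.905`. -/
def quarticDigits (k : ℕ) : ℤ :=
  if k = 1 ∨ Even k then 1 else 0

theorem remainder_quarticDigits {x : ℝ} (hx : x ^ 4 - x ^ 3 - 2 * x ^ 2 + 1 = 0) (j : ℕ) :
    remainder x quarticDigits 1 (2 * j + 2) = x ^ 2 - x - 1 ∧
      remainder x quarticDigits 1 (2 * j + 3) = x ^ 3 - x ^ 2 - x - 1 := by
  have hodd : ∀ j, remainder x quarticDigits 1 (2 * j + 2) = x ^ 2 - x - 1 →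
      remainder x quarticDigits 1 (2 * j + 3) = x ^ 3 - x ^ 2 - x - 1 := by
    intro j hj
    have hdigit : quarticDigits (2 * j + 2) = 1 := by simp [quarticDigits, parity_simps]
    rw [remainder, hj, hdigit]
    push_cast
    ring
  induction j with
  | zero =>
    have heven : remainder x quarticDigits 1 (2 * 0 + 2) = x ^ 2 - x - 1 := by
      have hdigit0 : quarticDigits 0 = 1 := rfl
      have hdigit1 : quarticDigits 1 = 1 := rfl
      simp only [remainder, hdigit0, hdigit1, Int.cast_one]
      ring
    exact ⟨heven, hodd 0 heven⟩
  | succ j ih =>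
    have heven : remainder x quarticDigits 1 (2 * (j + 1) + 2) = x ^ 2 - x - 1 := by
      have hdigit : quarticDigits (2 * j + 3) = 0 := by simp [quarticDigits, parity_simps]
      rw [show 2 * (j + 1) + 2 = 2 * j + 3 + 1 by ring, remainder, ih.2, hdigit]
      push_cast
      linear_combination hx
    exact ⟨heven, hodd _ heven⟩

theorem remainder_quarticDigits_cases {x : ℝ} (hx : x ^ 4 - x ^ 3 - 2 * x ^ 2 + 1 = 0) (k : ℕ) :
    quarticDigits k = 1 ∧ (remainder x quarticDigits 1 k = 1 ∨
        remainder x quarticDigits 1 k = x - 1 ∨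
        remainder x quarticDigits 1 k = x ^ 2 - x - 1) ∨
      quarticDigits k = 0 ∧ remainder x quarticDigits 1 k = x ^ 3 - x ^ 2 - x - 1 := by
  rcases k with _ | _ | k
  · simp [quarticDigits, remainder]
  · simp [quarticDigits, remainder]
  · rcases Nat.even_or_odd' k with ⟨j, rfl | rfl⟩
    · exact Or.inl ⟨by simp [quarticDigits, parity_simps],
        Or.inr (Or.inr (remainder_quarticDigits hx j).1)⟩
    · exact Or.inr ⟨by simp [quarticDigits, parity_simps], (remainder_quarticDigits hx j).2⟩

theorem isUnivoque_of_quartic {x : ℝ} (hx1 : 1.9 < x) (hx2 : x < 1.91)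
    (hx : x ^ 4 - x ^ 3 - 2 * x ^ 2 + 1 = 0) : IsUnivoque x := by
  have heven_gt : 0.71 < x ^ 2 - x - 1 := by nlinarith
  have heven_lt : x ^ 2 - x - 1 < 0.74 := by nlinarith
  have hodd : x ^ 3 - x ^ 2 - x - 1 = x * (x ^ 2 - x - 1) - 1 := by ring
  have hodd_gt : 0.34 < x ^ 3 - x ^ 2 - x - 1 := by rw [hodd]; nlinarith
  have hodd_lt : x ^ 3 - x ^ 2 - x - 1 < 0.42 := by rw [hodd]; nlinarith
  refine (isUnivoque_iff_exists_isForced (by linarith) (by linarith)).2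
    ⟨quarticDigits, ⟨fun k => ?_, fun k => ?_⟩, fun k => ?_⟩ <;>
    rcases remainder_quarticDigits_cases hx k with ⟨hdigit, hrem⟩ | ⟨hdigit, hrem⟩
  · exact Or.inr hdigit
  · exact Or.inl hdigit
  · rcases hrem with hrem | hrem | hrem <;> rw [hrem] <;> constructor <;> nlinarith
  · rw [hrem]
    constructor <;> nlinarith
  · refine ⟨by simp [hdigit], fun _ => ?_⟩
    rcases hrem with hrem | hrem | hrem <;> rw [hrem] <;> nlinarith
  · refine ⟨fun _ => ?_, by simp [hdigit]⟩
    rw [hrem]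
    nlinarith

theorem exists_isPisot_mem_univoqueSet : ∃ x, IsPisot x ∧ x ∈ univoqueSet := by
  have hcont : Continuous fun x : ℝ => x ^ 4 - x ^ 3 - 2 * x ^ 2 + 1 := by fun_prop
  obtain ⟨x, ⟨hx1, hx2⟩, hx⟩ := intermediate_value_Ioo (by norm_num : (1.9 : ℝ) ≤ 1.91)
    hcont.continuousOn (show (0 : ℝ) ∈ Set.Ioo _ _ by constructor <;> norm_num)
  obtain ⟨y, ⟨hy1, hy2⟩, hy⟩ := intermediate_value_Ioo' (by norm_num : (0.66 : ℝ) ≤ 0.68)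
    hcont.continuousOn (show (0 : ℝ) ∈ Set.Ioo _ _ by constructor <;> norm_num)
  exact ⟨x, isPisot_of_quartic hx1 hx2 hy1 hy2 hx hy, ⟨by linarith, by linarith⟩,
    isUnivoque_of_quartic hx1 hx2 hx⟩

end Example

theorem mainTheorem2 :
    ∃ θ : ℝ, IsLeast {β : ℝ | IsPisot β ∧ β ∈ univoqueSet} θ := by
  set A : Set ℝ := {β | IsPisot β ∧ β ∈ univoqueSet}
  have hlow : 3 / 2 ∈ lowerBounds A := fun β ⟨_, hβ⟩ => by
    nlinarith [hβ.2.one_lt_sub_one_mul_self hβ.1.2.le, hβ.1.1]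
  have hA : A.Nonempty := exists_isPisot_mem_univoqueSet
  have hglb : IsGLB A (sInf A) := isGLB_csInf hA ⟨_, hlow⟩
  have h1 : 1 < sInf A := by linarith [hglb.2 hlow]
  have h2 : sInf A < 2 := (hglb.1 hA.some_mem).trans_lt hA.some_mem.2.1.2
  refine ⟨sInf A, ?_, hglb.1⟩
  by_contra hmem
  refine hmem ⟨isPisot_of_mem_closure h1 ?_, ⟨h1, h2⟩, isUnivoque_of_frequently_nhdsGT h1 h2 ?_⟩
  · exact closure_mono (fun β hβ => hβ.1) (hglb.mem_closure hA)
  · refine frequently_nhdsWithin_iff.2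
      ((frequently_nhdsWithin_iff.1 (hglb.frequently_mem hA)).mono fun β ⟨hβ, hle⟩ => ?_)
    exact ⟨hβ.2.2, hle.lt_of_ne fun heq : sInf A = β => hmem (heq ▸ hβ)⟩
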